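/- Let $N\ge 1$ and let $\mathbb S=\mathbb C\{0,1\}^N$ be the free complex vector space on the binary strings of length $N$; write $m_j\in\{0,1\}$ ($1\le j\le N$) for the coefficient of $2^{j-1}$ in the fixed-width binary number $m$. Define linear operators on $\mathbb S$ as follows. - For $2\le k\le N$, $B^{k}$ sends a basis vector $m$ to $m+2^{k-1}-2^{k-2}$ if this requires no carrying in any digit (that is, if $m_k=0$ and $m_{k-1}=1$), and to $0$ otherwise; $B^{-k}$ sends $m$ to $m-2^{k-1}+2^{k-2}$ if this requires no carrying (that is, if $m_k=1$ and $m_{k-1}=0$), and to $0$ otherwise. - $B^{1}$ sends $m$ to $m+1$ if $m_1=0$ and to $0$ otherwise; $B^{-1}$ sends $m$ to $m-1$ if $m_1=1$ and to $0$ otherwise. - For $1\le l\le N$, $p_l$ sends $m$ to $(-1)^{m_l}m$. Let $\mathfrak k_N\subset\operatorname{End}_{\mathbb C}(\mathbb S)$ be the real Lie algebra generated, under the commutator bracket, by $$Q^k_+=B^k-B^{-k},\qquad Q^k_-=i\,(B^k+B^{-k}),\qquad i\,p_l\qquad(1\le k,l\le N).$$ Then $\mathfrak k_N$ is isomorphic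 to the compact real Lie algebra $\mathfrak{so}(2N+1)$ of real skew-symmetric $(2N+1)\times(2N+1)$ matrices, and, under a suitable isomorphism $\mathfrak{so}(2N+1)\cong\mathfrak k_N$, its representation on $\mathbb S$ is the fundamental complex spin representation of $\mathfrak{so}(2N+1)$. Here the complex spin representation is the restriction, along the embedding of Lie algebras $\mathfrak{so}(n)\to \mathrm{Cl}(\mathbb R^{n})$, $A\mapsto\frac14\sum_{i,j}A_{ij}e_ie_j$ (where $e_ie_j+e_je_i=2\delta_{ij}$, $n=2N+1$), of an irreducible complex representation of the Clifford algebra $\mathrm{Cl}(\mathbb R^{n})$; up to equivalence it does not depend on the choice of the irreducible representation. -/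

import Mathlib

attribute [local instance 100] LieRing.ofAssociativeRing

namespace BinarySpin

/-! ### Binary strings and arithmetic operators -/

/-- Binary strings of fixed width `N`, i.e. fixed width binary numbers: `m j` is the coefficient
of `2 ^ j`, so that digit number `l` (for `1 ≤ l ≤ N`) is `m (l - 1)`. -/
abbrev BinStr (N : ℕ) : Type := Fin N → Fin 2

/-- The free complex vector space on the binary strings of width `N`. -/
abbrev SpinSpace (N : ℕ) : Type := BinStr N →₀ ℂ

/-- The formal sum `∑ j, ε j * 2 ^ j` can be added to `m` digit by digit, without any carrying
or borrowing. -/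
def NoCarry {N : ℕ} (ε : Fin N → ℤ) (m : BinStr N) : Prop :=
  ∀ j, ((m j : ℕ) : ℤ) + ε j = 0 ∨ ((m j : ℕ) : ℤ) + ε j = 1

open Classical in
/-- The arithmetic function `m ↦ m + ∑ j, ε j * 2 ^ j`, which by convention fixes `m` if the
addition would require carrying. -/
noncomputable def arithFun {N : ℕ} (ε : Fin N → ℤ) (m : BinStr N) : BinStr N :=
  if NoCarry ε m then fun j => if ((m j : ℕ) : ℤ) + ε j = 1 then 1 else 0 else m

/-- The arithmetic operator of the formal sum `∑ j, ε j * 2 ^ j`: the linear operator that sends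
a basis vector `m` to `0` if the arithmetic function fixes `m`, and to its image otherwise. -/
noncomputable def arithOp {N : ℕ} (ε : Fin N → ℤ) : Module.End ℂ (SpinSpace N) :=
  Finsupp.linearCombination ℂ fun m : BinStr N =>
    if arithFun ε m = m then (0 : SpinSpace N) else Finsupp.single (arithFun ε m) 1

/-- The parity operator `m ↦ (-1) ^ (m j) m` of the digit with index `j`. -/
noncomputable def parityOp {N : ℕ} (j : Fin N) : Module.End ℂ (SpinSpace N) :=
  Finsupp.linearCombination ℂ fun m : BinStr N =>
    Finsupp.single m ((-1 : ℂ) ^ (m j : ℕ))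

/-- The formal sum `2 ^ k - 2 ^ (k - 1)` if `k ≠ 0`, and `2 ^ 0` if `k = 0`. -/
def shiftCoeff {N : ℕ} (k : Fin N) (j : Fin N) : ℤ :=
  if j = k then 1 else if (j : ℕ) + 1 = k then -1 else 0

/-- The operator `B^(k+1)`: the arithmetic operator of `2 ^ k - 2 ^ (k - 1)`, or of `1` if
`k = 0`. -/
noncomputable def Bpos {N : ℕ} (k : Fin N) : Module.End ℂ (SpinSpace N) :=
  arithOp (shiftCoeff k)

/-- The operator `B^(-(k+1))`: the arithmetic operator of `-2 ^ k + 2 ^ (k - 1)`, or of `-1` if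
`k = 0`. -/
noncomputable def Bneg {N : ℕ} (k : Fin N) : Module.End ℂ (SpinSpace N) :=
  arithOp (-shiftCoeff k)

/-- `Q₊ = B^k - B^(-k)`. -/
noncomputable def Qplus {N : ℕ} (k : Fin N) : Module.End ℂ (SpinSpace N) :=
  Bpos k - Bneg k

/-- `Q₋ = i (B^k + B^(-k))`. -/
noncomputable def Qminus {N : ℕ} (k : Fin N) : Module.End ℂ (SpinSpace N) :=
  Complex.I • (Bpos k + Bneg k)

/-- The real Lie algebra of operators on `ℂ{0,1}^N` generated by all the `Q₊`, `Q₋` and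
`i p`. -/
noncomputable def compactAlgebra (N : ℕ) : LieSubalgebra ℝ (Module.End ℂ (SpinSpace N)) :=
  LieSubalgebra.lieSpan ℝ (Module.End ℂ (SpinSpace N))
    (Set.range (Qplus (N := N)) ∪ Set.range (Qminus (N := N)) ∪
      Set.range fun l : Fin N => Complex.I • parityOp l)

/-! ### The complex spin representation of `so(n)` -/

/-- The standard positive definite quadratic form on `ℝ^n`. -/
noncomputable abbrev stdForm (n : ℕ) : QuadraticForm ℝ (Fin n → ℝ) :=
  QuadraticMap.weightedSumSquares ℝ fun _ : Fin n => (1 : ℝ)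

/-- The Clifford algebra of Euclidean space `ℝ^n`, with `v * v = ‖v‖ ^ 2`. -/
abbrev Cl (n : ℕ) : Type := CliffordAlgebra (stdForm n)

/-- The Clifford generator `e i`. -/
noncomputable def cliffE {n : ℕ} (i : Fin n) : Cl n :=
  CliffordAlgebra.ι (stdForm n) (Pi.single i 1)

/-- `so(n)`: the real Lie algebra of skew-symmetric `n × n` matrices. -/
abbrev so (n : ℕ) : LieSubalgebra ℝ (Matrix (Fin n) (Fin n) ℝ) :=
  LieAlgebra.Orthogonal.so (Fin n) ℝ

/-- The linear map `A ↦ (1/4) ∑ i, ∑ j, A i j e i e j` into the Clifford algebra. -/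
noncomputable def spinLin (n : ℕ) : Matrix (Fin n) (Fin n) ℝ →ₗ[ℝ] Cl n where
  toFun A := (1 / 4 : ℝ) • ∑ i, ∑ j, A i j • (cliffE i * cliffE j)
  map_add' A B := by
    simp [add_smul, Finset.sum_add_distrib, smul_add]
  map_smul' r A := by
    simp only [Matrix.smul_apply, smul_eq_mul, mul_smul, RingHom.id_apply, Finset.smul_sum]
    simp only [smul_comm r]

theorem cliffE_anticomm {n : ℕ} (i j : Fin n) :
    (cliffE i * cliffE j + cliffE j * cliffE i : Cl n) =
      algebraMap ℝ (Cl n) (if i = j then 2 else 0) := by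
  unfold cliffE
  rw [CliffordAlgebra.ι_mul_ι_add_swap]
  congr 1
  simp only [QuadraticMap.polar, QuadraticMap.weightedSumSquares_apply, Pi.add_apply, one_smul]
  rw [← Finset.sum_sub_distrib, ← Finset.sum_sub_distrib]
  by_cases h : i = j
  · subst h
    rw [Finset.sum_eq_single i]
    · norm_num
    · intro b _ hb; simp [hb]
    · simp
  · rw [if_neg h]
    apply Finset.sum_eq_zero
    intro b _
    by_cases hi : b = i
    · subst hi; simp [h]
    · simp [hi]

/-- For skew-symmetric `A`, the commutator with the image of `A` acts on vectors as `A`. -/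
theorem spinLin_lie_cliffE {n : ℕ} (A : so n) (k : Fin n) :
    spinLin n A.1 * cliffE k - cliffE k * spinLin n A.1 = ∑ i, A.1 i k • cliffE i := by
  have hA : ∀ i j, A.1 j i = -A.1 i j := fun i j => by
    have h := (LieAlgebra.Orthogonal.mem_so (Fin n) ℝ A.1).1 A.2
    exact congrFun (congrFun h i) j
  have key : ∀ i j : Fin n, (cliffE i * cliffE j) * cliffE k - cliffE k * (cliffE i * cliffE j)
      = (if j = k then (2 : ℝ) else 0) • cliffE i - (if i = k then (2 : ℝ) else 0) • cliffE j := by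
    intro i j
    have h1 := cliffE_anticomm j k
    have h2 := cliffE_anticomm i k
    have e : (cliffE i * cliffE j) * cliffE k - cliffE k * (cliffE i * cliffE j) =
        cliffE i * (cliffE j * cliffE k + cliffE k * cliffE j) -
          (cliffE i * cliffE k + cliffE k * cliffE i) * cliffE j := by noncomm_ring
    rw [e, h1, h2, ← Algebra.commutes, Algebra.smul_def, Algebra.smul_def]
  have e : spinLin n A.1 * cliffE k - cliffE k * spinLin n A.1 =
      (1 / 4 : ℝ) • ∑ i, ∑ j, A.1 i j •
        ((cliffE i * cliffE j) * cliffE k - cliffE k * (cliffE i * cliffE j)) := by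
    simp only [spinLin, LinearMap.coe_mk, AddHom.coe_mk, smul_mul_assoc, mul_smul_comm,
      Finset.sum_mul, Finset.mul_sum, smul_sub, Finset.sum_sub_distrib]
  rw [e]
  simp only [key, smul_sub, Finset.sum_sub_distrib, ite_smul, zero_smul, smul_ite, smul_zero,
    Finset.sum_ite_eq', Finset.mem_univ, if_true]
  rw [Finset.sum_comm (γ := Fin n)]
  simp only [Finset.sum_ite_eq', Finset.mem_univ, if_true, Finset.smul_sum, smul_smul]
  rw [← Finset.sum_sub_distrib]
  refine Finset.sum_congr rfl fun i _ => ?_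
  rw [hA i k, ← sub_smul]
  congr 1
  ring

/-- The embedding `so(n) → Cl(n)` of Lie algebras, whose image is spanned by the products
`e i e j` with `i ≠ j`. -/
noncomputable def spinEmbedding (n : ℕ) : so n →ₗ⁅ℝ⁆ Cl n where
  toFun A := spinLin n A.1
  map_add' A B := by simp
  map_smul' r A := by simp
  map_lie' := by
    intro A B
    have hskew : ∀ i j, A.1 j i = -A.1 i j := fun i j => by
      have h := (LieAlgebra.Orthogonal.mem_so (Fin n) ℝ A.1).1 A.2
      exact congrFun (congrFun h i) j
    have key : ∀ i j : Fin n,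
        spinLin n A.1 * (cliffE i * cliffE j) - (cliffE i * cliffE j) * spinLin n A.1 =
          (∑ k, A.1 k i • (cliffE k * cliffE j)) + ∑ k, A.1 k j • (cliffE i * cliffE k) := by
      intro i j
      have e : spinLin n A.1 * (cliffE i * cliffE j) - (cliffE i * cliffE j) * spinLin n A.1 =
          (spinLin n A.1 * cliffE i - cliffE i * spinLin n A.1) * cliffE j +
            cliffE i * (spinLin n A.1 * cliffE j - cliffE j * spinLin n A.1) := by noncomm_ring
      rw [e, spinLin_lie_cliffE, spinLin_lie_cliffE]
      simp only [Finset.sum_mul, Finset.mul_sum, smul_mul_assoc, mul_smul_comm]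
    have expand : spinLin n A.1 * spinLin n B.1 - spinLin n B.1 * spinLin n A.1 =
        (1 / 4 : ℝ) • ∑ i, ∑ j, B.1 i j •
          (spinLin n A.1 * (cliffE i * cliffE j) - (cliffE i * cliffE j) * spinLin n A.1) := by
      conv_lhs => rw [show spinLin n B.1 =
        (1 / 4 : ℝ) • ∑ i, ∑ j, B.1 i j • (cliffE i * cliffE j) from rfl]
      simp only [smul_mul_assoc, mul_smul_comm, Finset.sum_mul, Finset.mul_sum, smul_sub,
        Finset.sum_sub_distrib]
    rw [Ring.lie_def, expand, LieSubalgebra.coe_bracket, Ring.lie_def]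
    change (1 / 4 : ℝ) • ∑ i, ∑ j, (A.1 * B.1 - B.1 * A.1) i j • (cliffE i * cliffE j) = _
    congr 1
    simp only [key, smul_add, Finset.smul_sum, smul_smul, Finset.sum_add_distrib,
      Matrix.sub_apply, Matrix.mul_apply, sub_smul, Finset.sum_smul, Finset.sum_sub_distrib]
    rw [sub_eq_add_neg]
    congr 1
    · calc ∑ i, ∑ j, ∑ k, (A.1 i k * B.1 k j) • (cliffE i * cliffE j : Cl n)
          = ∑ i, ∑ k, ∑ j, (A.1 i k * B.1 k j) • (cliffE i * cliffE j : Cl n) :=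
            Finset.sum_congr rfl fun i _ => Finset.sum_comm
        _ = ∑ k, ∑ i, ∑ j, (A.1 i k * B.1 k j) • (cliffE i * cliffE j : Cl n) :=
            Finset.sum_comm
        _ = ∑ k, ∑ j, ∑ i, (A.1 i k * B.1 k j) • (cliffE i * cliffE j : Cl n) :=
            Finset.sum_congr rfl fun i _ => Finset.sum_comm
        _ = _ := by simp only [mul_comm (B.1 _ _)]
    · simp only [← Finset.sum_neg_distrib]
      refine Finset.sum_congr rfl fun i _ => ?_
      rw [Finset.sum_comm]
      refine Finset.sum_congr rfl fun k _ => Finset.sum_congr rfl fun j _ => ?_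
      rw [hskew k j, ← neg_smul, mul_neg]

/-- A complex representation `ρ` of `so(n)` is a complex spin representation if it is the
restriction, along the embedding `so(n) → Cl(n)`, of an irreducible complex representation of the
Clifford algebra `Cl(n)`. -/
def IsComplexSpinRep {n : ℕ} {S : Type*} [AddCommGroup S] [Module ℂ S] [Module ℝ S]
    [IsScalarTower ℝ ℂ S] [SMulCommClass ℝ ℂ S] (ρ : so n →ₗ⁅ℝ⁆ Module.End ℂ S) : Prop :=
  ∃ c : Cl n →ₐ[ℝ] Module.End ℂ S,
    (Nontrivial S ∧
      ∀ W : Submodule ℂ S, (∀ x : Cl n, ∀ w ∈ W, c x w ∈ W) → W = ⊥ ∨ W = ⊤) ∧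
    ∀ A : so n, ρ A = c (spinEmbedding n A)

end BinarySpin

/-!
The Jordan–Wigner operators `X_k`, `Y_k` (flip the digit `k`, with signs counting the parity of the
digits above it) together with the chirality operator `Z` satisfy the Clifford relations, so the
products of two of them generate a copy of `so(2N + 1)` acting by a spin representation. Expanding
the no-carry condition in characters of `(ℤ/2)^N` turns the arithmetic operators into combinations
of the same Pauli strings: `Q¹₊ = X₁Z`, `Q¹₋ = Y₁Z`, `i p_k = X_k Y_k`, and for `k ≥ 2`
`Q^k₊ = (X_k X_{k-1} + Y_k Y_{k-1}) / 2`, `Q^k₋ = (Y_k X_{k-1} + Y_{k-1} X_k) / 2`. Conversely,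
bracketing with `Q^k₊` and `Q^k₋` turns `X_{k-1} Z` into `X_k Z` and `Y_k Z`, and the brackets of
these with one another are, up to scalars, all the remaining products. The representation is
irreducible because the parities of the digits separate the basis vectors and the `X_k` connect
them.
-/

namespace BinarySpin

/-! ### Clifford families -/

/-- A family of elements of a ring satisfying the relations of an orthonormal basis in a Clifford
algebra: they square to `1` and anticommute pairwise. -/
structure IsCliffordFamily {ι A : Type*} [Ring A] (g : ι → A) : Prop where
  mul_self : ∀ i, g i * g i = 1
  mul_comm_neg : ∀ i j, i ≠ j → g i * g j = -(g j * g i)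

theorem mul_eq_neg_mul_symm {A : Type*} [Ring A] {a b : A} (h : a * b = -(b * a)) :
    b * a = -(a * b) := by
  rw [h, neg_neg]

theorem smul_mul_eq_neg_mul_smul {R A : Type*} [CommRing R] [Ring A] [Algebra R A] {a b : A}
    (h : a * b = -(b * a)) (r : R) : (r • a) * b = -(b * (r • a)) := by
  rw [smul_mul_assoc, h, smul_neg, mul_smul_comm]

/-- The Lie algebra generated by the products `g i * g j` with `i ≠ j`. For a Clifford family it is
the image of `so(n)` under the spin representation. -/
def bivectorAlgebra {ι A : Type*} [Ring A] [Algebra ℝ A] (g : ι → A) : LieSubalgebra ℝ A :=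
  LieSubalgebra.lieSpan ℝ A {x | ∃ i j, i ≠ j ∧ g i * g j = x}

section BivectorAlgebra

variable {ι κ A : Type*} [Ring A] [Algebra ℝ A]

theorem mul_mem_bivectorAlgebra (g : ι → A) {i j : ι} (hij : i ≠ j) :
    g i * g j ∈ bivectorAlgebra g :=
  LieSubalgebra.subset_lieSpan ⟨i, j, hij, rfl⟩

theorem bivectorAlgebra_le {g : ι → A} {L : LieSubalgebra ℝ A}
    (h : ∀ i j, i ≠ j → g i * g j ∈ L) : bivectorAlgebra g ≤ L :=
  LieSubalgebra.lieSpan_le.2 fun _ ⟨i, j, hij, hx⟩ => hx ▸ h i j hij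

theorem bivectorAlgebra_comp_equiv (g : ι → A) (e : κ ≃ ι) :
    bivectorAlgebra (g ∘ e) = bivectorAlgebra g := by
  refine le_antisymm (bivectorAlgebra_le fun i j hij => ?_) (bivectorAlgebra_le fun i j hij => ?_)
  · exact mul_mem_bivectorAlgebra g (e.injective.ne hij)
  · simpa using mul_mem_bivectorAlgebra (g ∘ e) (e.symm.injective.ne hij)

end BivectorAlgebra

namespace IsCliffordFamily

section Ring

variable {ι κ A : Type*} [Ring A] {g : ι → A}

theorem comp_injective (h : IsCliffordFamily g) {f : κ → ι} (hf : Function.Injective f) :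
    IsCliffordFamily (g ∘ f) where
  mul_self i := h.mul_self (f i)
  mul_comm_neg i j hij := h.mul_comm_neg (f i) (f j) (hf.ne hij)

theorem lie_mul_right (h : IsCliffordFamily g) {i j : ι} (hij : i ≠ j) :
    ⁅g i * g j, g j⁆ = 2 * g i := by
  rw [Ring.lie_def, ← mul_assoc, h.mul_comm_neg j i hij.symm, neg_mul, mul_assoc, h.mul_self]
  noncomm_ring

theorem lie_mul_eq_zero (h : IsCliffordFamily g) {i j k : ι} (hik : i ≠ k) (hjk : j ≠ k) :
    ⁅g i * g j, g k⁆ = 0 := by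
  rw [Ring.lie_def, mul_assoc, h.mul_comm_neg j k hjk, mul_neg, ← mul_assoc,
    h.mul_comm_neg i k hik, neg_mul, neg_neg, mul_assoc, sub_self]

theorem lie_mul_mul (h : IsCliffordFamily g) {i j k : ι} (hij : i ≠ j) (hik : i ≠ k)
    (hjk : j ≠ k) : ⁅g i * g j, g j * g k⁆ = 2 * (g i * g k) := by
  have leibniz : ⁅g i * g j, g j * g k⁆ = ⁅g i * g j, g j⁆ * g k + g j * ⁅g i * g j, g k⁆ := by
    simp only [Ring.lie_def]; noncomm_ring
  rw [leibniz, h.lie_mul_right hij, h.lie_mul_eq_zero hik hjk, mul_zero, add_zero, mul_assoc]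

theorem lie_mul_mul_eq_zero (h : IsCliffordFamily g) {i j k l : ι} (hik : i ≠ k) (hjk : j ≠ k)
    (hil : i ≠ l) (hjl : j ≠ l) : ⁅g i * g j, g k * g l⁆ = 0 := by
  have leibniz : ⁅g i * g j, g k * g l⁆ = ⁅g i * g j, g k⁆ * g l + g k * ⁅g i * g j, g l⁆ := by
    simp only [Ring.lie_def]; noncomm_ring
  rw [leibniz, h.lie_mul_eq_zero hik hjk, h.lie_mul_eq_zero hil hjl, zero_mul, mul_zero, add_zero]

theorem sum_smul_mul_self {R : Type*} [CommRing R] [Algebra R A] (h : IsCliffordFamily g)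
    (s : Finset ι) (v : ι → R) :
    (∑ i ∈ s, v i • g i) * (∑ i ∈ s, v i • g i) = algebraMap R A (∑ i ∈ s, v i * v i) := by
  classical
  induction s using Finset.induction_on with
  | empty => simp
  | insert i s hi ih =>
    have hcross : g i * (∑ j ∈ s, v j • g j) = -((∑ j ∈ s, v j • g j) * g i) := by
      rw [Finset.mul_sum, Finset.sum_mul, ← Finset.sum_neg_distrib]
      refine Finset.sum_congr rfl fun j hj => ?_
      rw [mul_smul_comm, h.mul_comm_neg i j (ne_of_mem_of_not_mem hj hi).symm, smul_neg,
        smul_mul_assoc]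
    have hsq : v i • (v i • (g i * g i)) = algebraMap R A (v i * v i) := by
      rw [h.mul_self, smul_smul, Algebra.algebraMap_eq_smul_one]
    simp only [Finset.sum_insert hi, add_mul, mul_add, smul_mul_assoc, mul_smul_comm, hcross, ih,
      smul_add, hsq, map_add, smul_neg]
    abel

theorem linearIndependent {K : Type*} [Field K] [LinearOrder K] [IsStrictOrderedRing K]
    [Algebra K A] [Nontrivial A] (h : IsCliffordFamily g) : LinearIndependent K g := by
  refine linearIndependent_iff'.2 fun s v hv i hi => ?_
  have hsq : ∑ i ∈ s, v i * v i = 0 := by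
    rw [← map_eq_zero_iff _ (algebraMap K A).injective, ← h.sum_smul_mul_self, hv, zero_mul]
  exact mul_self_eq_zero.1
    ((Finset.sum_eq_zero_iff_of_nonneg fun i _ => mul_self_nonneg (v i)).1 hsq i hi)

end Ring

section RealAlgebra

variable {ι A : Type*} [Ring A] [Algebra ℝ A] {g : ι → A}

theorem inv_two_smul_lie_mul_mul (h : IsCliffordFamily g) {i j k : ι} (hij : i ≠ j) (hik : i ≠ k)
    (hjk : j ≠ k) : (2⁻¹ : ℝ) • ⁅g i * g j, g j * g k⁆ = g i * g k := by
  rw [h.lie_mul_mul hij hik hjk, two_mul]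
  module

theorem lie_inv_two_smul_mul_add_mul (h : IsCliffordFamily g) {i j k i' j' : ι} (hij : i ≠ j)
    (hik : i ≠ k) (hjk : j ≠ k) (hij' : i' ≠ j) (hjj' : j' ≠ j) (hik' : i' ≠ k) (hjk' : j' ≠ k) :
    ⁅(2⁻¹ : ℝ) • (g i * g j + g i' * g j'), g j * g k⁆ = g i * g k := by
  rw [smul_lie, add_lie, h.lie_mul_mul_eq_zero hij' hjj' hik' hjk', add_zero,
    h.inv_two_smul_lie_mul_mul hij hik hjk]

theorem bivectorAlgebra_le_of_mul_mem (h : IsCliffordFamily g) {L : LieSubalgebra ℝ A} (k : ι)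
    (hL : ∀ i, i ≠ k → g i * g k ∈ L) : bivectorAlgebra g ≤ L := by
  have hL' : ∀ j, j ≠ k → g k * g j ∈ L := fun j hj =>
    h.mul_comm_neg k j hj.symm ▸ neg_mem (hL j hj)
  refine bivectorAlgebra_le fun i j hij => ?_
  rcases eq_or_ne i k with rfl | hi
  · exact hL' j hij.symm
  rcases eq_or_ne j k with rfl | hj
  · exact hL i hij
  exact h.inv_two_smul_lie_mul_mul hi hij hj.symm ▸ L.smul_mem _ (L.lie_mem (hL i hi) (hL' j hj))

end RealAlgebra

section SpinRep

variable {n : ℕ} {A : Type*} [Ring A] [Algebra ℝ A] {g : Fin n → A}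

/-- The homomorphism from the Clifford algebra that sends the generators to a Clifford family. -/
noncomputable def lift (h : IsCliffordFamily g) : Cl n →ₐ[ℝ] A :=
  CliffordAlgebra.lift (stdForm n) ⟨Fintype.linearCombination ℝ g, fun v => by
    simp only [Fintype.linearCombination_apply, h.sum_smul_mul_self,
      QuadraticMap.weightedSumSquares_apply, one_smul]⟩

theorem lift_cliffE (h : IsCliffordFamily g) (i : Fin n) : h.lift (cliffE i) = g i := by
  simp [lift, cliffE]

/-- The restriction to `so(n)` of the representation of the Clifford algebra given by a Clifford
family. -/
noncomputable def spinRep (h : IsCliffordFamily g) : so n →ₗ⁅ℝ⁆ A :=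
  h.lift.toLieHom.comp (spinEmbedding n)

theorem lift_spinLin (h : IsCliffordFamily g) (M : Matrix (Fin n) (Fin n) ℝ) :
    h.lift (spinLin n M) = (4⁻¹ : ℝ) • ∑ i, ∑ j, M i j • (g i * g j) := by
  simp [spinLin, lift_cliffE]

theorem spinRep_apply (h : IsCliffordFamily g) (M : so n) :
    h.spinRep M = (4⁻¹ : ℝ) • ∑ i, ∑ j, M.1 i j • (g i * g j) :=
  h.lift_spinLin M.1

theorem lie_spinRep (h : IsCliffordFamily g) (M : so n) (k : Fin n) :
    ⁅h.spinRep M, g k⁆ = ∑ i, M.1 i k • g i := by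
  rw [Ring.lie_def]
  simpa [lift_cliffE] using! congrArg h.lift (spinLin_lie_cliffE M k)

theorem spinRep_injective [Nontrivial A] (h : IsCliffordFamily g) :
    Function.Injective h.spinRep := by
  refine (injective_iff_map_eq_zero h.spinRep).2 fun M hM => Subtype.ext (Matrix.ext fun i k => ?_)
  have hcol : ∑ i, M.1 i k • g i = 0 := by rw [← h.lie_spinRep, hM, zero_lie]
  exact Fintype.linearIndependent_iff.1 h.linearIndependent _ hcol i

theorem mul_mem_range_spinRep (h : IsCliffordFamily g) {i j : Fin n} (hij : i ≠ j) :
    g i * g j ∈ h.spinRep.range := by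
  have hskew : (2 : ℝ) • (Matrix.single i j (1 : ℝ) - Matrix.single j i 1) ∈ so n := by
    rw [LieAlgebra.Orthogonal.mem_so]
    simp [Matrix.transpose_single, ← smul_neg]
  have hsingle : ∀ a b : Fin n,
      h.lift (spinLin n (Matrix.single a b 1)) = (4⁻¹ : ℝ) • (g a * g b) := fun a b => by
    simp [lift_spinLin, Matrix.single_apply, ite_and]
  refine h.spinRep.mem_range _ |>.2 ⟨⟨_, hskew⟩, ?_⟩
  change h.lift (spinLin n _) = _
  rw [map_smul, map_sub, map_smul, map_sub, hsingle, hsingle, h.mul_comm_neg j i hij.symm]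
  module

theorem range_spinRep (h : IsCliffordFamily g) : h.spinRep.range = bivectorAlgebra g := by
  refine le_antisymm ?_ (bivectorAlgebra_le fun _ _ => h.mul_mem_range_spinRep)
  rintro _ ⟨M, rfl⟩
  change h.spinRep M ∈ bivectorAlgebra g
  have hdiag : ∀ i, M.1 i i = 0 := fun i => by
    have := congrFun₂ ((LieAlgebra.Orthogonal.mem_so (Fin n) ℝ M.1).1 M.2) i i
    simp only [Matrix.transpose_apply, Matrix.neg_apply] at this
    linarith
  rw [h.spinRep_apply]
  refine LieSubalgebra.smul_mem _ _ (sum_mem fun i _ => sum_mem fun j _ => ?_)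
  rcases eq_or_ne i j with rfl | hij
  · rw [hdiag, zero_smul]
    exact zero_mem _
  · exact LieSubalgebra.smul_mem _ _ (mul_mem_bivectorAlgebra g hij)

end SpinRep

end IsCliffordFamily

/-! ### Weighted shifts -/

/-- The weighted shift `m ↦ φ m • (m + s)` on the free module on an additive semigroup. -/
noncomputable def weightedShift {R G : Type*} [CommSemiring R] [Add G] (φ : G → R) (s : G) :
    Module.End R (G →₀ R) :=
  Finsupp.linearCombination R fun m => Finsupp.single (m + s) (φ m)

section WeightedShift

variable {R G : Type*} [CommSemiring R]

@[simp]
theorem weightedShift_single [Add G] (φ : G → R) (s m : G) (a : R) :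
    weightedShift φ s (Finsupp.single m a) = Finsupp.single (m + s) (a * φ m) := by
  simp [weightedShift]

theorem weightedShift_zero_apply [AddZeroClass G] (φ : G → R) (w : G →₀ R) (n : G) :
    weightedShift φ 0 w n = φ n * w n := by
  induction w using Finsupp.induction_linear with
  | zero => simp
  | add v w hv hw => simp [hv, hw, mul_add]
  | single m a =>
    rcases eq_or_ne m n with rfl | h
    · simp [mul_comm]
    · simp [h]

theorem weightedShift_mul [AddCommSemigroup G] (φ ψ : G → R) (s t : G) :
    weightedShift φ s * weightedShift ψ t = weightedShift (fun m => ψ m * φ (m + t)) (s + t) := by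
  ext m : 2
  simp [add_comm s t, add_assoc]

end WeightedShift

section Irreducible

variable {κ K G : Type*} [Field K]

theorem single_mem_of_separating [AddZeroClass G] {W : Submodule K (G →₀ K)} {F : Set (G → K)}
    (hsep : ∀ m n, m ≠ n → ∃ φ ∈ F, φ m ≠ φ n)
    (hW : ∀ φ ∈ F, ∀ w ∈ W, weightedShift φ 0 w ∈ W) {w : G →₀ K} (hw : w ∈ W) {m : G}
    (hm : w m ≠ 0) : Finsupp.single m 1 ∈ W := by
  classical
  -- Applying `φ - φ n` with `φ m ≠ φ n` removes `n` from the support and keeps `m`.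
  have hkill : ∀ s : Finset G, m ∉ s → ∃ v ∈ W, v m ≠ 0 ∧ v.support ⊆ w.support \ s := by
    intro s
    induction s using Finset.induction_on with
    | empty => exact fun _ => ⟨w, hw, hm, by simp⟩
    | insert n s _ ih =>
      intro hms
      rw [Finset.mem_insert, not_or] at hms
      obtain ⟨v, hv, hvm, hvs⟩ := ih hms.2
      obtain ⟨φ, hφ, hmn⟩ := hsep m n hms.1
      have happly : ∀ k, (weightedShift φ 0 v - φ n • v) k = (φ k - φ n) * v k := fun k => by
        simp [weightedShift_zero_apply, sub_mul]
      refine ⟨_, W.sub_mem (hW φ hφ v hv) (W.smul_mem (φ n) hv), ?_, fun k hk => ?_⟩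
      · rw [happly]
        exact mul_ne_zero (sub_ne_zero.2 hmn) hvm
      · rw [Finsupp.mem_support_iff, happly] at hk
        have hkn : k ≠ n := fun h => left_ne_zero_of_mul hk (by rw [h, sub_self])
        have hks := hvs (Finsupp.mem_support_iff.2 (right_ne_zero_of_mul hk))
        simp only [Finset.mem_sdiff, Finset.mem_insert] at hks ⊢
        exact ⟨hks.1, not_or.2 ⟨hkn, hks.2⟩⟩
  obtain ⟨v, hv, hvm, hvs⟩ := hkill (w.support.erase m) (Finset.notMem_erase m _)
  have hv_eq : v = Finsupp.single m (v m) :=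
    Finsupp.support_subset_singleton.1 fun k hk => by
      have := hvs hk
      simp only [Finset.mem_sdiff, Finset.mem_erase, not_and] at this
      exact Finset.mem_singleton.2 (by tauto)
  rw [hv_eq, ← mul_one (v m), ← smul_eq_mul, ← Finsupp.smul_single] at hv
  exact (W.smul_mem_iff hvm).1 hv

theorem eq_top_of_single_mem [AddCommGroup G] {W : Submodule K (G →₀ K)} {φ : κ → G → K}
    (hφ : ∀ k m, φ k m ≠ 0) {s : κ → G} (hs : AddSubmonoid.closure (Set.range s) = ⊤)
    (hW : ∀ k, ∀ w ∈ W, weightedShift (φ k) (s k) w ∈ W) {m : G}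
    (hm : Finsupp.single m 1 ∈ W) : W = ⊤ := by
  have hshift : ∀ n k, Finsupp.single n 1 ∈ W → Finsupp.single (n + s k) 1 ∈ W := by
    intro n k hn
    have := hW k _ hn
    rw [weightedShift_single, one_mul, ← mul_one (φ k n), ← smul_eq_mul,
      ← Finsupp.smul_single] at this
    exact (W.smul_mem_iff (hφ k n)).1 this
  have hall : ∀ t, Finsupp.single (m + t) 1 ∈ W := by
    intro t
    have ht : t ∈ AddSubmonoid.closure (Set.range s) := hs ▸ AddSubmonoid.mem_top t
    induction ht using AddSubmonoid.closure_induction_right with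
    | zero => rwa [add_zero]
    | add_right t _ u hu ih =>
      obtain ⟨k, rfl⟩ := hu
      exact add_assoc m t (s k) ▸ hshift _ k ih
  refine Submodule.eq_top_iff'.2 fun x => ?_
  rw [← Finsupp.sum_single x]
  refine W.sum_mem fun n _ => ?_
  simpa using W.smul_mem (x n) (hall (n - m))

theorem eq_bot_or_eq_top_of_weightedShift_mem [AddCommGroup G] {W : Submodule K (G →₀ K)}
    {F : Set (G → K)} (hsep : ∀ m n, m ≠ n → ∃ φ ∈ F, φ m ≠ φ n)
    (hF : ∀ φ ∈ F, ∀ w ∈ W, weightedShift φ 0 w ∈ W) {φ : κ → G → K} (hφ : ∀ k m, φ k m ≠ 0)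
    {s : κ → G} (hs : AddSubmonoid.closure (Set.range s) = ⊤)
    (hW : ∀ k, ∀ w ∈ W, weightedShift (φ k) (s k) w ∈ W) : W = ⊥ ∨ W = ⊤ := by
  refine or_iff_not_imp_left.2 fun hbot => ?_
  obtain ⟨w, hw, hw0⟩ := W.ne_bot_iff.1 hbot
  obtain ⟨m, hm⟩ := Finsupp.ne_iff.1 hw0
  exact eq_top_of_single_mem hφ hs hW (single_mem_of_separating hsep hF hw hm)

end Irreducible

/-! ### Pauli operators -/

section Walsh

variable {ι R : Type*} [CommRing R]

theorem neg_one_pow_val_add (a b : Fin 2) :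
    (-1 : R) ^ ((a + b : Fin 2) : ℕ) = (-1) ^ (a : ℕ) * (-1) ^ (b : ℕ) := by
  fin_cases a <;> fin_cases b <;> simp

/-- The Walsh character `m ↦ (-1) ^ ∑ j ∈ s, m j` of the group of binary strings, added digitwise
modulo `2`. -/
def walsh (s : Finset ι) : AddChar (ι → Fin 2) R where
  toFun m := ∏ j ∈ s, (-1) ^ (m j : ℕ)
  map_zero_eq_one' := by simp
  map_add_eq_mul' m n := by simp [neg_one_pow_val_add, Finset.prod_mul_distrib]

theorem walsh_apply (s : Finset ι) (m : ι → Fin 2) :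
    (walsh s m : R) = ∏ j ∈ s, (-1) ^ (m j : ℕ) := rfl

theorem walsh_mul_self (s : Finset ι) (m : ι → Fin 2) : (walsh s m * walsh s m : R) = 1 := by
  simp [walsh_apply, ← Finset.prod_mul_distrib, ← mul_pow]

theorem walsh_ne_zero [Nontrivial R] (s : Finset ι) (m : ι → Fin 2) : (walsh s m : R) ≠ 0 :=
  left_ne_zero_of_mul_eq_one (walsh_mul_self s m)

/-- The Pauli operator that flips the digits set in `t` and weights the result by the parity of the
digits in `s`: a product of Pauli `Z`-matrices at `s` followed by Pauli `X`-matrices at `t`. -/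
noncomputable def pauli (s : Finset ι) (t : ι → Fin 2) : Module.End R ((ι → Fin 2) →₀ R) :=
  weightedShift (walsh s) t

theorem pauli_single (s : Finset ι) (t m : ι → Fin 2) (a : R) :
    pauli s t (Finsupp.single m a) = Finsupp.single (m + t) (a * walsh s m) :=
  weightedShift_single _ _ _ _

theorem walsh_single [DecidableEq ι] (s : Finset ι) (l : ι) :
    (walsh s (Pi.single l 1) : R) = if l ∈ s then -1 else 1 := by
  have hdigit : ∀ j, (-1 : R) ^ ((Pi.single l 1 : ι → Fin 2) j : ℕ) = if l = j then -1 else 1 :=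
    fun j => by
      rcases eq_or_ne l j with rfl | h
      · simp
      · simp [h, h.symm]
  simp [walsh_apply, hdigit, Finset.prod_ite_eq]

theorem walsh_symmDiff [DecidableEq ι] (s t : Finset ι) (m : ι → Fin 2) :
    (walsh (symmDiff s t) m : R) = walsh s m * walsh t m := by
  have hs := Finset.prod_sdiff (f := fun j => (-1 : R) ^ (m j : ℕ))
    (Finset.inter_subset_left (s₁ := s) (s₂ := t))
  have ht := Finset.prod_sdiff (f := fun j => (-1 : R) ^ (m j : ℕ))
    (Finset.inter_subset_right (s₁ := s) (s₂ := t))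
  rw [Finset.sdiff_inter_self_left] at hs
  rw [Finset.sdiff_inter_self_right] at ht
  have hst : (walsh (symmDiff s t) m : R) = walsh (s \ t) m * walsh (t \ s) m :=
    Finset.prod_union disjoint_sdiff_sdiff
  have hinter := walsh_mul_self (R := R) (s ∩ t) m
  simp only [walsh_apply] at hst hinter ⊢
  rw [hst, ← hs, ← ht]
  linear_combination -(∏ j ∈ s \ t, (-1 : R) ^ (m j : ℕ)) * (∏ j ∈ t \ s, (-1) ^ (m j : ℕ)) * hinter

theorem closure_range_single_one [Finite ι] [DecidableEq ι] :
    AddSubmonoid.closure (Set.range fun k => (Pi.single k 1 : ι → Fin 2)) = ⊤ := by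
  have := Fintype.ofFinite ι
  refine (AddSubmonoid.eq_top_iff' _).2 fun m => ?_
  rw [← Finset.univ_sum_single m]
  refine sum_mem fun k _ => ?_
  have hk : m k = 0 ∨ m k = 1 := by omega
  rcases hk with hk | hk <;> rw [hk]
  · rw [Pi.single_zero]
    exact zero_mem _
  · exact AddSubmonoid.subset_closure ⟨k, rfl⟩

theorem pauli_mul [DecidableEq ι] (s s' : Finset ι) (t t' : ι → Fin 2) :
    (pauli s t * pauli s' t' : Module.End R _) =
      (walsh s t' : R) • pauli (symmDiff s s') (t + t') := by
  ext m : 2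
  simp only [pauli, weightedShift_mul, LinearMap.comp_apply, Finsupp.lsingle_apply,
    LinearMap.smul_apply, weightedShift_single, Finsupp.smul_single, smul_eq_mul,
    AddChar.map_add_eq_mul, walsh_symmDiff]
  congr 1
  ring

theorem pauli_mul_self (s : Finset ι) (t : ι → Fin 2) :
    (pauli s t * pauli s t : Module.End R _) = (walsh s t : R) • 1 := by
  classical
  have htt : t + t = 0 := funext fun j => by simp only [Pi.add_apply, Pi.zero_apply]; omega
  rw [pauli_mul, htt, symmDiff_self]
  congr 1
  ext m : 2
  simp [pauli_single, walsh_apply]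

theorem pauli_mul_eq_neg {s s' : Finset ι} {t t' : ι → Fin 2}
    (h : (walsh s t' : R) = -walsh s' t) :
    (pauli s t * pauli s' t' : Module.End R _) = -(pauli s' t' * pauli s t) := by
  classical
  rw [pauli_mul, pauli_mul, h, symmDiff_comm s' s, add_comm t' t]
  module

end Walsh

/-! ### Arithmetic operators as combinations of Pauli operators -/

theorem sum_powerset_singleton {ι M : Type*} [AddCommMonoid M] (f : Finset ι → M) (i : ι) :
    ∑ t ∈ ({i} : Finset ι).powerset, f t = f ∅ + f {i} := by
  classical
  simpa using Finset.sum_powerset_insert (Finset.notMem_empty i) f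

section Arithmetic

variable {N : ℕ}

/-- The digits with a nonzero coefficient in a formal sum `∑ j, ε j * 2 ^ j`. -/
def digitSupport (ε : Fin N → ℤ) : Finset (Fin N) := {j | ε j ≠ 0}

theorem mem_digitSupport {ε : Fin N → ℤ} {j : Fin N} : j ∈ digitSupport ε ↔ ε j ≠ 0 := by
  simp [digitSupport]

theorem digitSupport_neg (ε : Fin N → ℤ) : digitSupport (-ε) = digitSupport ε := by
  simp [digitSupport]

theorem sum_digitSupport_single (ε : Fin N → ℤ) :
    (∑ j ∈ digitSupport ε, Pi.single j 1 : BinStr N) = fun j => if ε j = 0 then 0 else 1 := by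
  funext j
  simp [digitSupport, Finset.sum_apply, Pi.single_apply, Finset.sum_ite_eq]

theorem arithFun_of_noCarry {ε : Fin N → ℤ} {m : BinStr N} (h : NoCarry ε m) :
    arithFun ε m = m + ∑ j ∈ digitSupport ε, Pi.single j 1 := by
  rw [arithFun, if_pos h, sum_digitSupport_single]
  funext j
  simp only [Pi.add_apply]
  have := h j
  split_ifs <;> omega

open Classical in
theorem arithOp_eq_weightedShift {ε : Fin N → ℤ} (hε : (digitSupport ε).Nonempty) :
    arithOp ε = weightedShift (fun m => if NoCarry ε m then 1 else 0)
      (∑ j ∈ digitSupport ε, Pi.single j 1) := by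
  have hne : (∑ j ∈ digitSupport ε, Pi.single j 1 : BinStr N) ≠ 0 := by
    obtain ⟨j, hj⟩ := hε
    rw [sum_digitSupport_single]
    exact Function.ne_iff.2 ⟨j, by simpa [digitSupport] using hj⟩
  ext m : 2
  by_cases h : NoCarry ε m
  · simp [arithOp, arithFun_of_noCarry h, hne, h]
  · simp [arithOp, arithFun, h]

open Classical in
theorem ite_noCarry_eq_prod {ε : Fin N → ℤ} (hε : ∀ j, |ε j| ≤ 1) (m : BinStr N) :
    (if NoCarry ε m then (1 : ℂ) else 0) =
      ∏ j ∈ digitSupport ε, (1 + (ε j : ℂ) * (-1) ^ (m j : ℕ)) / 2 := by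
  have hdigit : ∀ j,
      (if ((m j : ℕ) : ℤ) + ε j = 0 ∨ ((m j : ℕ) : ℤ) + ε j = 1 then (1 : ℂ) else 0) =
        if ε j ≠ 0 then (1 + (ε j : ℂ) * (-1) ^ (m j : ℕ)) / 2 else 1 := by
    intro j
    have hj := abs_le.1 (hε j)
    generalize ε j = e at hj ⊢
    generalize m j = a
    obtain ⟨h₁, h₂⟩ := hj
    interval_cases e <;> fin_cases a <;> norm_num
  rw [digitSupport, Finset.prod_filter, ← Finset.prod_congr rfl fun j _ => hdigit j,
    Fintype.prod_ite_zero, Finset.prod_const_one]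
  congr

theorem arithOp_eq_sum_pauli {ε : Fin N → ℤ} (hε : (digitSupport ε).Nonempty)
    (hε' : ∀ j, |ε j| ≤ 1) :
    arithOp ε = (2⁻¹ ^ (digitSupport ε).card : ℂ) • ∑ T ∈ (digitSupport ε).powerset,
      (∏ j ∈ T, (ε j : ℂ)) • pauli T (∑ j ∈ digitSupport ε, Pi.single j 1) := by
  rw [arithOp_eq_weightedShift hε]
  ext m : 2
  simp only [LinearMap.comp_apply, Finsupp.lsingle_apply, LinearMap.smul_apply,
    LinearMap.sum_apply, pauli_single, weightedShift_single, Finsupp.smul_single,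
    ← Finsupp.single_finsetSum, ite_noCarry_eq_prod hε', smul_eq_mul, one_mul, walsh_apply,
    ← Finset.prod_mul_distrib, ← Finset.prod_one_add, Finset.prod_div_distrib, Finset.prod_const]
  rw [div_eq_inv_mul, inv_pow]

theorem arithOp_of_digitSupport_eq_singleton {ε : Fin N → ℤ} {k : Fin N}
    (hk : digitSupport ε = {k}) (hε : ∀ j, |ε j| ≤ 1) :
    arithOp ε = (2⁻¹ : ℂ) • (pauli ∅ (Pi.single k 1) + (ε k : ℂ) • pauli {k} (Pi.single k 1)) := by
  rw [arithOp_eq_sum_pauli (by simp [hk]) hε, hk, sum_powerset_singleton]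
  simp

theorem arithOp_of_digitSupport_eq_pair {ε : Fin N → ℤ} {k l : Fin N} (hkl : k ≠ l)
    (hs : digitSupport ε = {k, l}) (hε : ∀ j, |ε j| ≤ 1) :
    arithOp ε = (4⁻¹ : ℂ) • (pauli ∅ (Pi.single k 1 + Pi.single l 1) +
      (ε k : ℂ) • pauli {k} (Pi.single k 1 + Pi.single l 1) +
      (ε l : ℂ) • pauli {l} (Pi.single k 1 + Pi.single l 1) +
      (ε k * ε l : ℂ) • pauli {k, l} (Pi.single k 1 + Pi.single l 1)) := by
  rw [arithOp_eq_sum_pauli (by simp [hs]) hε, hs, Finset.card_pair hkl,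
    Finset.sum_powerset_insert (by simpa using hkl), sum_powerset_singleton,
    sum_powerset_singleton, Finset.prod_pair hkl, Finset.sum_pair hkl,
    insert_empty_eq, Finset.prod_empty, Finset.prod_singleton, Finset.prod_singleton]
  module

theorem shiftCoeff_self (k : Fin N) : shiftCoeff k k = 1 := if_pos rfl

theorem shiftCoeff_of_succ_eq {k l : Fin N} (hl : (l : ℕ) + 1 = k) : shiftCoeff k l = -1 := by
  rw [shiftCoeff, if_neg (by omega), if_pos hl]

theorem abs_shiftCoeff_le_one (k j : Fin N) : |shiftCoeff k j| ≤ 1 := by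
  unfold shiftCoeff
  split_ifs <;> simp

theorem digitSupport_shiftCoeff_of_eq_zero {k : Fin N} (hk : (k : ℕ) = 0) :
    digitSupport (shiftCoeff k) = {k} := by
  ext j
  simp [digitSupport, shiftCoeff, hk]

theorem digitSupport_shiftCoeff_of_succ_eq {k l : Fin N} (hl : (l : ℕ) + 1 = k) :
    digitSupport (shiftCoeff k) = {k, l} := by
  ext j
  rw [mem_digitSupport, Finset.mem_insert, Finset.mem_singleton, shiftCoeff]
  split_ifs <;> simp only [ne_eq, one_ne_zero, neg_eq_zero, not_true_eq_false, not_false_eq_true,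
    true_iff, false_iff] <;> omega

theorem Bpos_eq_pauli_of_eq_zero {k : Fin N} (hk : (k : ℕ) = 0) :
    Bpos k = (2⁻¹ : ℂ) • (pauli ∅ (Pi.single k 1) + pauli {k} (Pi.single k 1)) := by
  rw [Bpos, arithOp_of_digitSupport_eq_singleton (digitSupport_shiftCoeff_of_eq_zero hk)
    (abs_shiftCoeff_le_one k), shiftCoeff_self, Int.cast_one, one_smul]

theorem Bneg_eq_pauli_of_eq_zero {k : Fin N} (hk : (k : ℕ) = 0) :
    Bneg k = (2⁻¹ : ℂ) • (pauli ∅ (Pi.single k 1) - pauli {k} (Pi.single k 1)) := by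
  rw [Bneg, arithOp_of_digitSupport_eq_singleton
    ((digitSupport_neg _).trans (digitSupport_shiftCoeff_of_eq_zero hk))
    fun j => (abs_neg _).trans_le (abs_shiftCoeff_le_one k j), Pi.neg_apply, shiftCoeff_self]
  module

theorem Bpos_eq_pauli_of_succ_eq {k l : Fin N} (hl : (l : ℕ) + 1 = k) :
    Bpos k = (4⁻¹ : ℂ) • (pauli ∅ (Pi.single k 1 + Pi.single l 1) +
      pauli {k} (Pi.single k 1 + Pi.single l 1) - pauli {l} (Pi.single k 1 + Pi.single l 1) -
      pauli {k, l} (Pi.single k 1 + Pi.single l 1)) := by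
  rw [Bpos, arithOp_of_digitSupport_eq_pair (by omega) (digitSupport_shiftCoeff_of_succ_eq hl)
    (abs_shiftCoeff_le_one k), shiftCoeff_self, shiftCoeff_of_succ_eq hl]
  module

theorem Bneg_eq_pauli_of_succ_eq {k l : Fin N} (hl : (l : ℕ) + 1 = k) :
    Bneg k = (4⁻¹ : ℂ) • (pauli ∅ (Pi.single k 1 + Pi.single l 1) -
      pauli {k} (Pi.single k 1 + Pi.single l 1) + pauli {l} (Pi.single k 1 + Pi.single l 1) -
      pauli {k, l} (Pi.single k 1 + Pi.single l 1)) := by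
  rw [Bneg, arithOp_of_digitSupport_eq_pair (by omega)
    ((digitSupport_neg _).trans (digitSupport_shiftCoeff_of_succ_eq hl))
    fun j => (abs_neg _).trans_le (abs_shiftCoeff_le_one k j), Pi.neg_apply, Pi.neg_apply,
    shiftCoeff_self, shiftCoeff_of_succ_eq hl]
  module

theorem Qplus_eq_pauli_of_eq_zero {k : Fin N} (hk : (k : ℕ) = 0) :
    Qplus k = pauli {k} (Pi.single k 1) := by
  rw [Qplus, Bpos_eq_pauli_of_eq_zero hk, Bneg_eq_pauli_of_eq_zero hk]
  module

theorem Qminus_eq_pauli_of_eq_zero {k : Fin N} (hk : (k : ℕ) = 0) :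
    Qminus k = Complex.I • pauli ∅ (Pi.single k 1) := by
  rw [Qminus, Bpos_eq_pauli_of_eq_zero hk, Bneg_eq_pauli_of_eq_zero hk]
  module

theorem Qplus_eq_pauli_of_succ_eq {k l : Fin N} (hl : (l : ℕ) + 1 = k) :
    Qplus k = (2⁻¹ : ℂ) • (pauli {k} (Pi.single k 1 + Pi.single l 1) -
      pauli {l} (Pi.single k 1 + Pi.single l 1)) := by
  rw [Qplus, Bpos_eq_pauli_of_succ_eq hl, Bneg_eq_pauli_of_succ_eq hl]
  module

theorem Qminus_eq_pauli_of_succ_eq {k l : Fin N} (hl : (l : ℕ) + 1 = k) :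
    Qminus k = (2⁻¹ * Complex.I) • (pauli ∅ (Pi.single k 1 + Pi.single l 1) -
      pauli {k, l} (Pi.single k 1 + Pi.single l 1)) := by
  rw [Qminus, Bpos_eq_pauli_of_succ_eq hl, Bneg_eq_pauli_of_succ_eq hl]
  module

theorem parityOp_eq_pauli (k : Fin N) : parityOp k = pauli {k} 0 := by
  ext m : 2
  simp [parityOp, pauli_single, walsh_apply]

end Arithmetic

/-! ### Gamma operators -/

section Gamma

variable {N : ℕ}

/-- The gamma operator `σₓ` at the digit `k` of the Jordan–Wigner construction, with the string of
`σ_z` running over the higher digits. -/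
noncomputable def gammaX (k : Fin N) : Module.End ℂ (SpinSpace N) :=
  pauli (Finset.Ioi k) (Pi.single k 1)

/-- The gamma operator `σ_y` (up to sign) at the digit `k` of the Jordan–Wigner construction. -/
noncomputable def gammaY (k : Fin N) : Module.End ℂ (SpinSpace N) :=
  Complex.I • pauli (Finset.Ici k) (Pi.single k 1)

/-- The chirality operator, which completes the gamma operators to a family of odd size. -/
noncomputable def gammaZ (N : ℕ) : Module.End ℂ (SpinSpace N) :=
  pauli Finset.univ 0

/-- The `2 * N + 1` gamma operators, with `none` the index of the chirality operator. -/
noncomputable def gamma : Option (Fin N ⊕ Fin N) → Module.End ℂ (SpinSpace N)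
  | none => gammaZ N
  | some (.inl k) => gammaX k
  | some (.inr k) => gammaY k

theorem gammaX_mul_self (k : Fin N) : gammaX k * gammaX k = 1 := by
  rw [gammaX, pauli_mul_self, walsh_single, if_neg (by simp), one_smul]

theorem gammaY_mul_self (k : Fin N) : gammaY k * gammaY k = 1 := by
  rw [gammaY, smul_mul_smul_comm, pauli_mul_self, walsh_single, if_pos (by simp), smul_smul,
    Complex.I_mul_I, neg_mul_neg, one_mul, one_smul]

theorem gammaZ_mul_self : gammaZ N * gammaZ N = 1 := by
  rw [gammaZ, pauli_mul_self, AddChar.map_zero_eq_one, one_smul]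

theorem gammaX_mul_gammaX_neg {k l : Fin N} (hkl : k ≠ l) :
    gammaX k * gammaX l = -(gammaX l * gammaX k) := by
  refine pauli_mul_eq_neg ?_
  rcases hkl.lt_or_gt with h | h <;> simp [walsh_single, h, h.le]

theorem gammaY_mul_gammaX_neg (k l : Fin N) :
    gammaY k * gammaX l = -(gammaX l * gammaY k) := by
  refine smul_mul_eq_neg_mul_smul (A := Module.End ℂ (SpinSpace N)) (pauli_mul_eq_neg ?_) Complex.I
  rcases lt_or_ge l k with h | h
  · simp [walsh_single, h, h.not_ge]
  · simp [walsh_single, h, h.not_gt]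

theorem gammaY_mul_gammaY_neg {k l : Fin N} (hkl : k ≠ l) :
    gammaY k * gammaY l = -(gammaY l * gammaY k) := by
  have hpauli : (pauli (Finset.Ici l) (Pi.single l 1) * pauli (Finset.Ici k) (Pi.single k 1) :
      Module.End ℂ (SpinSpace N)) = -(pauli (Finset.Ici k) (Pi.single k 1) *
        pauli (Finset.Ici l) (Pi.single l 1)) := by
    refine pauli_mul_eq_neg ?_
    rcases hkl.lt_or_gt with h | h <;> simp [walsh_single, h.not_ge, h.le]
  exact smul_mul_eq_neg_mul_smul (A := Module.End ℂ (SpinSpace N)) (mul_eq_neg_mul_symm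
    (smul_mul_eq_neg_mul_smul (A := Module.End ℂ (SpinSpace N)) hpauli Complex.I)) Complex.I

theorem gammaX_mul_gammaZ_neg (k : Fin N) : gammaX k * gammaZ N = -(gammaZ N * gammaX k) :=
  pauli_mul_eq_neg (by simp [walsh_single])

theorem gammaY_mul_gammaZ_neg (k : Fin N) : gammaY k * gammaZ N = -(gammaZ N * gammaY k) :=
  smul_mul_eq_neg_mul_smul (A := Module.End ℂ (SpinSpace N))
    (pauli_mul_eq_neg (by simp [walsh_single])) Complex.I

theorem isCliffordFamily_gamma : IsCliffordFamily (gamma (N := N)) where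
  mul_self
    | none => gammaZ_mul_self
    | some (.inl k) => gammaX_mul_self k
    | some (.inr k) => gammaY_mul_self k
  mul_comm_neg
    | none, none, h => absurd rfl h
    | none, some (.inl k), _ => mul_eq_neg_mul_symm (gammaX_mul_gammaZ_neg k)
    | none, some (.inr k), _ => mul_eq_neg_mul_symm (gammaY_mul_gammaZ_neg k)
    | some (.inl k), none, _ => gammaX_mul_gammaZ_neg k
    | some (.inr k), none, _ => gammaY_mul_gammaZ_neg k
    | some (.inl _), some (.inl _), h => gammaX_mul_gammaX_neg fun hkl => h (hkl ▸ rfl)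
    | some (.inr _), some (.inr _), h => gammaY_mul_gammaY_neg fun hkl => h (hkl ▸ rfl)
    | some (.inl k), some (.inr l), _ => mul_eq_neg_mul_symm (gammaY_mul_gammaX_neg l k)
    | some (.inr k), some (.inl l), _ => gammaY_mul_gammaX_neg k l

theorem gammaX_mul_gammaX_of_succ_eq {k l : Fin N} (hl : (l : ℕ) + 1 = k) :
    gammaX k * gammaX l = pauli {k} (Pi.single k 1 + Pi.single l 1) := by
  have hlk : l < k := by omega
  have hs : symmDiff (Finset.Ioi k) (Finset.Ioi l) = {k} := by
    grind [Finset.mem_symmDiff]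
  rw [gammaX, gammaX, pauli_mul, hs, walsh_single, if_neg (by simp [hlk.le]), one_smul]

theorem gammaY_mul_gammaY_of_succ_eq {k l : Fin N} (hl : (l : ℕ) + 1 = k) :
    gammaY k * gammaY l =
      -(pauli {l} (Pi.single k 1 + Pi.single l 1) : Module.End ℂ (SpinSpace N)) := by
  have hlk : l < k := by omega
  have hs : symmDiff (Finset.Ici k) (Finset.Ici l) = {l} := by
    grind [Finset.mem_symmDiff]
  rw [gammaY, gammaY, smul_mul_smul_comm, pauli_mul, hs, walsh_single, if_neg (by simp [hlk]),
    Complex.I_mul_I, one_smul]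
  module

theorem gammaY_mul_gammaX_of_succ_eq {k l : Fin N} (hl : (l : ℕ) + 1 = k) :
    gammaY k * gammaX l = Complex.I • pauli ∅ (Pi.single k 1 + Pi.single l 1) := by
  have hlk : l < k := by omega
  have hs : symmDiff (Finset.Ici k) (Finset.Ioi l) = ∅ := by
    grind [Finset.mem_symmDiff]
  rw [gammaY, gammaX, smul_mul_assoc, pauli_mul, hs, walsh_single, if_neg (by simp [hlk]),
    one_smul]

theorem gammaX_mul_gammaY_of_succ_eq {k l : Fin N} (hl : (l : ℕ) + 1 = k) :
    gammaX k * gammaY l = Complex.I • pauli {k, l} (Pi.single k 1 + Pi.single l 1) := by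
  have hlk : l < k := by omega
  have hs : symmDiff (Finset.Ioi k) (Finset.Ici l) = {k, l} := by
    grind [Finset.mem_symmDiff]
  rw [gammaX, gammaY, mul_smul_comm, pauli_mul, hs, walsh_single, if_neg (by simp [hlk.le]),
    one_smul]

theorem gammaX_mul_gammaY_self (k : Fin N) : gammaX k * gammaY k = Complex.I • parityOp k := by
  have hs : symmDiff (Finset.Ioi k) (Finset.Ici k) = {k} := by
    grind [Finset.mem_symmDiff]
  have ht : (Pi.single k 1 + Pi.single k 1 : BinStr N) = 0 := by
    rw [← Pi.single_add]; exact Pi.single_zero k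
  rw [gammaX, gammaY, mul_smul_comm, pauli_mul, hs, ht, walsh_single, if_neg (by simp), one_smul,
    parityOp_eq_pauli]

theorem Qplus_eq_gamma_of_eq_zero {k : Fin N} (hk : (k : ℕ) = 0) :
    Qplus k = gammaX k * gammaZ N := by
  have hs : symmDiff (Finset.Ioi k) Finset.univ = {k} := by
    grind [Finset.mem_symmDiff]
  rw [gammaX, gammaZ, pauli_mul, hs, AddChar.map_zero_eq_one, one_smul, add_zero,
    Qplus_eq_pauli_of_eq_zero hk]

theorem Qminus_eq_gamma_of_eq_zero {k : Fin N} (hk : (k : ℕ) = 0) :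
    Qminus k = gammaY k * gammaZ N := by
  have hs : symmDiff (Finset.Ici k) Finset.univ = ∅ := by
    grind [Finset.mem_symmDiff]
  rw [gammaY, gammaZ, smul_mul_assoc, pauli_mul, hs, AddChar.map_zero_eq_one, one_smul, add_zero,
    Qminus_eq_pauli_of_eq_zero hk]

theorem Qplus_eq_gamma_of_succ_eq {k l : Fin N} (hl : (l : ℕ) + 1 = k) :
    Qplus k = (2⁻¹ : ℝ) • (gammaX k * gammaX l + gammaY k * gammaY l) := by
  rw [gammaX_mul_gammaX_of_succ_eq hl, gammaY_mul_gammaY_of_succ_eq hl,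
    Qplus_eq_pauli_of_succ_eq hl, ← algebraMap_smul ℂ (2⁻¹ : ℝ), Complex.coe_algebraMap,
    Complex.ofReal_inv, Complex.ofReal_ofNat]
  module

theorem Qminus_eq_gamma_of_succ_eq {k l : Fin N} (hl : (l : ℕ) + 1 = k) :
    Qminus k = (2⁻¹ : ℝ) • (gammaY k * gammaX l + gammaY l * gammaX k) := by
  rw [gammaY_mul_gammaX_of_succ_eq hl, gammaY_mul_gammaX_neg l k, gammaX_mul_gammaY_of_succ_eq hl,
    Qminus_eq_pauli_of_succ_eq hl, ← algebraMap_smul ℂ (2⁻¹ : ℝ), Complex.coe_algebraMap,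
    Complex.ofReal_inv, Complex.ofReal_ofNat]
  module

theorem eq_zero_or_exists_succ_eq (k : Fin N) : (k : ℕ) = 0 ∨ ∃ l : Fin N, (l : ℕ) + 1 = k := by
  rcases Nat.eq_zero_or_pos k with hk | hk
  · exact .inl hk
  · exact .inr ⟨⟨k - 1, by omega⟩, Nat.sub_add_cancel hk⟩

theorem lie_Qplus_gammaX_mul_gammaZ {k l : Fin N} (hl : (l : ℕ) + 1 = k) :
    ⁅Qplus k, gammaX l * gammaZ N⁆ = gammaX k * gammaZ N := by
  have hkl : k ≠ l := by omega
  rw [Qplus_eq_gamma_of_succ_eq hl]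
  exact isCliffordFamily_gamma.lie_inv_two_smul_mul_add_mul (i := some (.inl k))
    (j := some (.inl l)) (k := none) (i' := some (.inr k)) (j' := some (.inr l))
    (by simpa using hkl) (by simp) (by simp) (by simp) (by simp) (by simp) (by simp)

theorem lie_Qminus_gammaX_mul_gammaZ {k l : Fin N} (hl : (l : ℕ) + 1 = k) :
    ⁅Qminus k, gammaX l * gammaZ N⁆ = gammaY k * gammaZ N := by
  have hkl : k ≠ l := by omega
  rw [Qminus_eq_gamma_of_succ_eq hl]
  exact isCliffordFamily_gamma.lie_inv_two_smul_mul_add_mul (i := some (.inr k))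
    (j := some (.inl l)) (k := none) (i' := some (.inr l)) (j' := some (.inl k))
    (by simp) (by simp) (by simp) (by simp) (by simpa using hkl) (by simp) (by simp)

end Gamma

/-! ### The compact algebra and its representation -/

section CompactAlgebra

variable {N : ℕ}

theorem Qplus_mem_compactAlgebra (k : Fin N) : Qplus k ∈ compactAlgebra N :=
  LieSubalgebra.subset_lieSpan (.inl (.inl ⟨k, rfl⟩))

theorem Qminus_mem_compactAlgebra (k : Fin N) : Qminus k ∈ compactAlgebra N :=
  LieSubalgebra.subset_lieSpan (.inl (.inr ⟨k, rfl⟩))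

theorem gammaX_mul_gammaZ_mem_compactAlgebra (k : Fin N) :
    gammaX k * gammaZ N ∈ compactAlgebra N := by
  induction k using WellFoundedLT.induction with
  | ind k ih =>
    rcases eq_zero_or_exists_succ_eq k with hk | ⟨l, hl⟩
    · exact Qplus_eq_gamma_of_eq_zero hk ▸ Qplus_mem_compactAlgebra k
    · exact lie_Qplus_gammaX_mul_gammaZ hl ▸
        LieSubalgebra.lie_mem _ (Qplus_mem_compactAlgebra k) (ih l (by omega))

theorem gammaY_mul_gammaZ_mem_compactAlgebra (k : Fin N) :
    gammaY k * gammaZ N ∈ compactAlgebra N := by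
  rcases eq_zero_or_exists_succ_eq k with hk | ⟨l, hl⟩
  · exact Qminus_eq_gamma_of_eq_zero hk ▸ Qminus_mem_compactAlgebra k
  · exact lie_Qminus_gammaX_mul_gammaZ hl ▸ LieSubalgebra.lie_mem _ (Qminus_mem_compactAlgebra k)
      (gammaX_mul_gammaZ_mem_compactAlgebra l)

theorem Qplus_mem_bivectorAlgebra (k : Fin N) : Qplus k ∈ bivectorAlgebra (gamma (N := N)) := by
  rcases eq_zero_or_exists_succ_eq k with hk | ⟨l, hl⟩
  · rw [Qplus_eq_gamma_of_eq_zero hk]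
    exact mul_mem_bivectorAlgebra gamma (i := some (.inl k)) (j := none) (by simp)
  · have hkl : k ≠ l := by omega
    rw [Qplus_eq_gamma_of_succ_eq hl]
    exact LieSubalgebra.smul_mem _ _ (add_mem
      (mul_mem_bivectorAlgebra gamma (i := some (.inl k)) (j := some (.inl l)) (by simpa using hkl))
      (mul_mem_bivectorAlgebra gamma (i := some (.inr k)) (j := some (.inr l))
        (by simpa using hkl)))

theorem Qminus_mem_bivectorAlgebra (k : Fin N) : Qminus k ∈ bivectorAlgebra (gamma (N := N)) := by
  rcases eq_zero_or_exists_succ_eq k with hk | ⟨l, hl⟩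
  · rw [Qminus_eq_gamma_of_eq_zero hk]
    exact mul_mem_bivectorAlgebra gamma (i := some (.inr k)) (j := none) (by simp)
  · rw [Qminus_eq_gamma_of_succ_eq hl]
    exact LieSubalgebra.smul_mem _ _ (add_mem
      (mul_mem_bivectorAlgebra gamma (i := some (.inr k)) (j := some (.inl l)) (by simp))
      (mul_mem_bivectorAlgebra gamma (i := some (.inr l)) (j := some (.inl k)) (by simp)))

theorem smul_parityOp_mem_bivectorAlgebra (k : Fin N) :
    Complex.I • parityOp k ∈ bivectorAlgebra (gamma (N := N)) :=
  gammaX_mul_gammaY_self k ▸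
    mul_mem_bivectorAlgebra gamma (i := some (.inl k)) (j := some (.inr k)) (by simp)

theorem compactAlgebra_eq_bivectorAlgebra (N : ℕ) :
    compactAlgebra N = bivectorAlgebra (gamma (N := N)) := by
  refine le_antisymm (LieSubalgebra.lieSpan_le.2 ?_)
    (isCliffordFamily_gamma.bivectorAlgebra_le_of_mul_mem none ?_)
  · rintro _ ((⟨k, rfl⟩ | ⟨k, rfl⟩) | ⟨k, rfl⟩)
    · exact Qplus_mem_bivectorAlgebra k
    · exact Qminus_mem_bivectorAlgebra k
    · exact smul_parityOp_mem_bivectorAlgebra k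
  · rintro (_ | k | k) hk
    · exact absurd rfl hk
    · exact gammaX_mul_gammaZ_mem_compactAlgebra k
    · exact gammaY_mul_gammaZ_mem_compactAlgebra k

theorem eq_bot_or_eq_top_of_gamma_mem {W : Submodule ℂ (SpinSpace N)}
    (hW : ∀ i, ∀ w ∈ W, gamma i w ∈ W) : W = ⊥ ∨ W = ⊤ := by
  have hparity : ∀ k, ∀ w ∈ W, parityOp k w ∈ W := fun k w hw => by
    refine (W.smul_mem_iff Complex.I_ne_zero).1 ?_
    rw [← LinearMap.smul_apply, ← gammaX_mul_gammaY_self]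
    exact hW (some (.inl k)) _ (hW (some (.inr k)) w hw)
  refine eq_bot_or_eq_top_of_weightedShift_mem (F := Set.range fun k => walsh {k})
    (fun m n hmn => ?_) ?_ (φ := fun k => walsh (Finset.Ioi k)) (fun k => walsh_ne_zero _)
    closure_range_single_one fun k => hW (some (.inl k))
  · obtain ⟨k, hk⟩ := Function.ne_iff.1 hmn
    refine ⟨_, ⟨k, rfl⟩, ?_⟩
    simp only [walsh_apply, Finset.prod_singleton]
    generalize m k = a at hk
    generalize n k = b at hk
    fin_cases a <;> fin_cases b <;> first | exact absurd rfl hk | norm_num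
  · rintro _ ⟨k, rfl⟩ w hw
    have := hparity k w hw
    rwa [parityOp_eq_pauli] at this

/-- An enumeration of the `2 * N + 1` indices of the gamma operators. -/
noncomputable def gammaIndex (N : ℕ) : Fin (2 * N + 1) ≃ Option (Fin N ⊕ Fin N) :=
  (Fintype.equivFinOfCardEq (by simp [two_mul])).symm

theorem isCliffordFamily_gamma_gammaIndex (N : ℕ) :
    IsCliffordFamily (gamma ∘ gammaIndex N) :=
  isCliffordFamily_gamma.comp_injective (gammaIndex N).injective

theorem range_spinRep_gamma (N : ℕ) :
    (isCliffordFamily_gamma_gammaIndex N).spinRep.range = compactAlgebra N :=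
  (IsCliffordFamily.range_spinRep _).trans
    ((bivectorAlgebra_comp_equiv gamma _).trans (compactAlgebra_eq_bivectorAlgebra N).symm)

theorem isComplexSpinRep_spinRep_gamma (N : ℕ) :
    IsComplexSpinRep (isCliffordFamily_gamma_gammaIndex N).spinRep := by
  refine ⟨(isCliffordFamily_gamma_gammaIndex N).lift, ⟨inferInstance, fun W hW => ?_⟩,
    fun _ => rfl⟩
  refine eq_bot_or_eq_top_of_gamma_mem fun i w hw => ?_
  have := hW (cliffE ((gammaIndex N).symm i)) w hw
  rwa [IsCliffordFamily.lift_cliffE, Function.comp_apply, Equiv.apply_symm_apply] at this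

end CompactAlgebra

end BinarySpin

theorem mainTheorem4 (N : ℕ) (hN : 0 < N) :
    ∃ e : BinarySpin.so (2 * N + 1) ≃ₗ⁅ℝ⁆ BinarySpin.compactAlgebra N,
      BinarySpin.IsComplexSpinRep ((BinarySpin.compactAlgebra N).incl.comp e.toLieHom) := by
  have hgamma := BinarySpin.isCliffordFamily_gamma_gammaIndex N
  exact ⟨(LieEquiv.ofInjective hgamma.spinRep hgamma.spinRep_injective).trans
    (LieEquiv.ofEq _ _ (congrArg _ (BinarySpin.range_spinRep_gamma N))),
    BinarySpin.isComplexSpinRep_spinRep_gamma N⟩
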